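/- Let $K$ be a field and let $\mathbb X\subseteq\mathbb P^n_K$ be a non-empty $0$-dimensional closed subscheme with homogeneous (saturated) vanishing ideal $I_{\mathbb X}\subseteq K[X_0,\dots,X_n]$ and homogeneous coordinate ring $R=K[X_0,\dots,X_n]/I_{\mathbb X}$; write $x_0$ for the image of $X_0$ in $R$. Assume that no point of $\mathbb X$ lies on the hyperplane $\mathcal Z(X_0)$, so that $\mathbb X=\operatorname{Spec} S$ with $S=R/\langle x_0-1\rangle$, and that $\operatorname{char}(K)=0$ or $\operatorname{char}(K)>\deg(\mathbb X)=\dim_K S$. Let $p_1,\dots,p_s$ be the closed points of $\mathbb X$, let $\mathcal O_{\mathbb X,p_j}$ be the local ring of $\mathbb X$ at $p_j$ and $K(p_j)$ its residue field. Call $p_j$ a Gorenstein point if $\mathcal O_{\mathbb X,p_j}$ is a Gorenstein local ring, let $\mathbb X_{\rm gor}$ be the set of Gorenstein points, and call $\mathbb X$ locally Gorenstein if every $p_j$ is a Gorenstein point. Let $\mu\colon R\otimes_{K[x_0]}R\to R$ be the multiplication map, $J=\ker\mu$, and let $\vartheta_N=\mu\bigl(\operatorname{Ann}_{R\otimes_{K[x_0]}R}(J)\bigr)$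 be the Noether different of $\mathbb X$. Its Hilbert polynomial $\operatorname{HP}_{\vartheta_N}\in\mathbb Q[z]$ is the polynomial with $\dim_K(\vartheta_N)_i=\operatorname{HP}_{\vartheta_N}(i)$ for all $i\gg0$. Then the Hilbert polynomial of $\vartheta_N$ is the constant $$\operatorname{HP}_{\vartheta_N}=\sum_{p_j\in\mathbb X_{\rm gor}}\dim_K K(p_j).$$ In particular, $\mathbb X$ is locally Gorenstein if and only if $\operatorname{HP}_{\vartheta_N}=\sum_{j=1}^s\dim_K K(p_j)$. -/

import Mathlib

open scoped TensorProduct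

noncomputable section

attribute [local instance] MvPolynomial.gradedAlgebra

/-- A Noetherian local ring is Gorenstein if it has finite injective dimension
as a module over itself. -/
def IsGorensteinLocalRing (A : Type*) [CommRing A] : Prop :=
  IsNoetherianRing A ∧ IsLocalRing A ∧
    ∃ d : ℕ, CategoryTheory.HasInjectiveDimensionLE (ModuleCat.of A A) d

/-- The Noether different of an `A`-algebra `B`: the image under the multiplication map
`μ : B ⊗[A] B → B` of the annihilator of `J = ker μ`. -/
def noetherDifferentIdeal (A B : Type*) [CommRing A] [CommRing B] [Algebra A B] : Ideal B :=
  (KaehlerDifferential.ideal A B).annihilator.map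
    (Algebra.TensorProduct.lmul' A : B ⊗[A] B →ₐ[A] B)

/-- A non-empty zero-dimensional closed subscheme of the projective space `ℙⁿ` over `K`,
given by its homogeneous vanishing ideal: a homogeneous ideal of `K[X₀, …, Xₙ]` which is
saturated with respect to `(X₀, …, Xₙ)` and whose residue class ring has Krull dimension `1`
(i.e. the subscheme is non-empty of dimension `0`). -/
structure ZeroDimSubscheme (K : Type*) [Field K] (n : ℕ) where
  /-- The homogeneous vanishing ideal. -/
  vanishingIdeal : Ideal (MvPolynomial (Fin (n + 1)) K)
  isHomogeneous :
    vanishingIdeal.IsHomogeneous (MvPolynomial.homogeneousSubmodule (Fin (n + 1)) K)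
  isSaturated : ∀ (k : ℕ) (f : MvPolynomial (Fin (n + 1)) K),
    (∀ i, MvPolynomial.X i ^ k * f ∈ vanishingIdeal) → f ∈ vanishingIdeal
  ringKrullDim_eq_one :
    ringKrullDim (MvPolynomial (Fin (n + 1)) K ⧸ vanishingIdeal) = 1

namespace ZeroDimSubscheme

variable {K : Type*} [Field K] {n : ℕ} (X : ZeroDimSubscheme K n)

/-- The set of points of the subscheme, as a subset of `ℙⁿ = Proj K[X₀, …, Xₙ]`. -/
def support : Set (ProjectiveSpectrum (MvPolynomial.homogeneousSubmodule (Fin (n + 1)) K)) :=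
  ProjectiveSpectrum.zeroLocus _ (X.vanishingIdeal : Set (MvPolynomial (Fin (n + 1)) K))

/-- No point of the subscheme lies on the hyperplane `X₀ = 0`. -/
def AvoidsHyperplane : Prop :=
  X.support ∩ ProjectiveSpectrum.zeroLocus _ {MvPolynomial.X 0} = ∅

/-- The homogeneous coordinate ring `R = K[X₀, …, Xₙ] / I`. -/
def CoordRing : Type _ := MvPolynomial (Fin (n + 1)) K ⧸ X.vanishingIdeal

instance : CommRing X.CoordRing :=
  inferInstanceAs (CommRing (MvPolynomial (Fin (n + 1)) K ⧸ X.vanishingIdeal))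

instance : Algebra K X.CoordRing :=
  inferInstanceAs (Algebra K (MvPolynomial (Fin (n + 1)) K ⧸ X.vanishingIdeal))

/-- The residue class map `K[X₀, …, Xₙ] → R`. -/
def toCoordRing : MvPolynomial (Fin (n + 1)) K →ₐ[K] X.CoordRing :=
  Ideal.Quotient.mkₐ K X.vanishingIdeal

/-- The residue class `x₀` of `X₀` in `R`. -/
def x₀ : X.CoordRing := X.toCoordRing (MvPolynomial.X 0)

/-- The homogeneous component `R_i` of `R`. -/
def component (i : ℕ) : Submodule K X.CoordRing :=
  (MvPolynomial.homogeneousSubmodule (Fin (n + 1)) K i).map X.toCoordRing.toLinearMap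

/-- The Hilbert function `i ↦ dim_K (N ∩ R_i)` of a homogeneous ideal `N` of `R`
(it vanishes in negative degrees). -/
def hilbertFunction (N : Ideal X.CoordRing) (i : ℕ) : ℕ :=
  Module.finrank K ↥(N.restrictScalars K ⊓ X.component i)

/-- `h` is a Hilbert polynomial of `N`: it agrees with the Hilbert function in all large
degrees. -/
def IsHilbertPolynomial (N : Ideal X.CoordRing) (h : Polynomial ℚ) : Prop :=
  ∃ i₀ : ℕ, ∀ i : ℕ, i₀ ≤ i → (X.hilbertFunction N i : ℚ) = h.eval (i : ℚ)

theorem IsHilbertPolynomial.unique {X : ZeroDimSubscheme K n} {N : Ideal X.CoordRing}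
    {g h : Polynomial ℚ} (hg : X.IsHilbertPolynomial N g) (hh : X.IsHilbertPolynomial N h) :
    g = h := by
  obtain ⟨a, ha⟩ := hg
  obtain ⟨b, hb⟩ := hh
  refine Polynomial.eq_of_infinite_eval_eq g h
    (((Set.Ici_infinite (max a b)).image Nat.cast_injective.injOn).mono ?_)
  rintro _ ⟨i, hi, rfl⟩
  have hi' : max a b ≤ i := hi
  exact (ha i (le_trans (le_max_left _ _) hi')).symm.trans
    (hb i (le_trans (le_max_right _ _) hi'))

open Classical in
/-- The Hilbert polynomial of `N` (with the value `0` if there is none). -/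
def hilbertPolynomial (N : Ideal X.CoordRing) : Polynomial ℚ :=
  if h : ∃ p, X.IsHilbertPolynomial N p then h.choose else 0

/-- The Noether different of the subscheme, i.e. of the algebra `R / K[x₀]`. -/
def noetherDifferent : Ideal X.CoordRing :=
  noetherDifferentIdeal (Algebra.adjoin K {X.x₀}) X.CoordRing

/-- The affine coordinate ring `S = R / (x₀ - 1)` of the subscheme in `D₊(X₀) ≅ 𝔸ⁿ`. -/
def AffineCoordRing : Type _ := X.CoordRing ⧸ Ideal.span {X.x₀ - 1}

instance : CommRing X.AffineCoordRing :=
  inferInstanceAs (CommRing (X.CoordRing ⧸ Ideal.span {X.x₀ - 1}))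

instance : Algebra K X.AffineCoordRing :=
  inferInstanceAs (Algebra K (X.CoordRing ⧸ Ideal.span {X.x₀ - 1}))

/-- The degree `dim_K S` of the subscheme (for a subscheme avoiding `X₀ = 0`). -/
def degree : ℕ := Module.finrank K X.AffineCoordRing

/-- The closed points of the subscheme. When it avoids the hyperplane `X₀ = 0` it is
`Spec S`, and its closed points are the maximal ideals of `S`. -/
abbrev ClosedPoint : Type _ := MaximalSpectrum X.AffineCoordRing

/-- The local ring of the subscheme at a closed point. -/
abbrev LocalRingAt (p : X.ClosedPoint) : Type _ := Localization.AtPrime p.asIdeal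

/-- `κ(p) = dim_K K(p)`, where `K(p)` is the residue field of the local ring at `p`. -/
def residueDegree (p : X.ClosedPoint) : ℕ :=
  Module.finrank K (IsLocalRing.ResidueField (X.LocalRingAt p))

/-- The set of Gorenstein points. -/
def gorensteinPoints : Set X.ClosedPoint := {p | IsGorensteinLocalRing (X.LocalRingAt p)}

/-- All local rings of the subscheme are Gorenstein. -/
def IsLocallyGorenstein : Prop := ∀ p : X.ClosedPoint, IsGorensteinLocalRing (X.LocalRingAt p)

end ZeroDimSubscheme

end

/-! In large degrees `i`, setting `x₀ = 1` identifies `R_i` with `S`, and it carries the degree `i`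
part of the Noether different of `R/K[x₀]` onto that of `S/K`. A tensor over `S` annihilated by `ker
μ` lifts by homogenizing both factors, because over `K[x₀]` the element `x₀` may cross the tensor
sign. So the Hilbert polynomial is the constant `dim_K` of the different of `S/K`, which splits over
the local factors of `S`.

Let `S` be local and let `t` be annihilated by `ker μ`. Contracting the first factor of `t` with a
functional `σ` gives multiplication by some `c_σ`, and `σ (μ t) = Tr c_σ` (`apply_lmul'_eq_trace`).
If `c_σ` is a unit then `σ` is a Frobenius form. Without such a form every `c_σ` is nilpotent, all
the traces vanish, and the different is zero. With a Frobenius form `ψ`, the tensor contracting to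
the identity has `ψ (μ t) = dim S`, which is nonzero in `K` by the characteristic assumption. The
different is then a nonzero ideal killed by the maximal ideal, and self-injectivity makes it a copy
of the residue field. `isGorensteinLocalRing_iff` identifies Gorenstein with the existence of a
Frobenius form. -/

noncomputable section

attribute [local instance] MvPolynomial.gradedAlgebra

/-! ### Gorenstein local Artinian algebras and Frobenius forms. -/

section Gorenstein

open CategoryTheory Abelian

universe u

variable {A : Type u} [CommRing A]

/-- The short exact sequence `0 → I → A → A ⧸ I → 0`. -/
theorem shortExact_ideal_quotient (I : Ideal A) :
    (ModuleCat.shortComplexOfCompEqZero I.subtype (I.mkQ)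
      (LinearMap.exact_subtype_mkQ I).linearMap_comp_eq_zero).ShortExact := by
  refine ModuleCat.shortComplex_shortExact _ ?_ I.injective_subtype I.mkQ_surjective
  exact LinearMap.exact_subtype_mkQ I

/-- Baer's criterion in terms of `Ext¹`. -/
theorem baer_of_subsingleton_ext_one (M : ModuleCat.{u} A)
    (h : ∀ I : Ideal A, Subsingleton (Ext (ModuleCat.of A (A ⧸ I)) M 1)) :
    Module.Baer A M := by
  intro I g
  have hS := shortExact_ideal_quotient I
  obtain ⟨x, hx⟩ := Ext.contravariant_sequence_exact₁ hS M
    (Ext.mk₀ (ModuleCat.ofHom g)) (add_zero 1) ((h I).elim _ _)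
  obtain ⟨f, rfl⟩ := Ext.homEquiv₀.symm.surjective x
  have key : ModuleCat.ofHom I.subtype ≫ f = ModuleCat.ofHom g :=
    Ext.homEquiv₀.symm.injective (by
      have := hx
      simp only [Ext.homEquiv₀, Equiv.symm_symm, Equiv.ofBijective_apply] at this ⊢
      rw [← this]
      exact (Ext.mk₀_comp_mk₀ _ _).symm)
  refine ⟨f.hom, fun x mem => ?_⟩
  have := congrArg (fun φ => φ.hom ⟨x, mem⟩) key
  simpa using this

/-- Vanishing of `Ext` on cyclic modules bounds the injective dimension. -/
theorem hasInjectiveDimensionLT_of_subsingleton_ext_quotient (n : ℕ) (M : ModuleCat.{u} A)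
    (h : ∀ I : Ideal A, Subsingleton (Ext (ModuleCat.of A (A ⧸ I)) M (n + 1))) :
    HasInjectiveDimensionLT M (n + 1) := by
  induction n generalizing M with
  | zero =>
    rw [zero_add, ← injective_iff_hasInjectiveDimensionLT_one]
    have : Module.Injective A M := (baer_of_subsingleton_ext_one M h).injective
    exact Module.injective_object_of_injective_module A M
  | succ n ih =>
    -- Dimension shift: the cokernel of an embedding into an injective satisfies the hypothesis one
    -- degree lower.
    obtain ⟨E, hE, f, hf⟩ := EnoughInjectives.presentation M
    let T := ShortComplex.mk f (Limits.cokernel.π f) (Limits.cokernel.condition f)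
    have hT : T.ShortExact := { exact := ShortComplex.exact_cokernel f }
    refine (hT.hasInjectiveDimensionLT_X₃_iff n hE).1 (ih _ fun I => ⟨fun x y => ?_⟩)
    rw [← sub_eq_zero]
    have : Injective T.X₂ := hE
    obtain ⟨z, hz⟩ := Ext.covariant_sequence_exact₃ _ hT (x - y) rfl ((h I).elim _ _)
    rw [← hz, Ext.eq_zero_of_injective z, Ext.zero_comp]

/-- An Artinian local ring of finite injective dimension over itself is self-injective. -/
theorem baer_self_of_hasInjectiveDimensionLE [IsLocalRing A] [IsArtinianRing A]
    {s : A} (hs : Ideal.torsionOf A A s = IsLocalRing.maximalIdeal A) (d : ℕ)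
    (hd : HasInjectiveDimensionLE (ModuleCat.of A A) d) : Module.Baer A A := by
  induction d with
  | zero =>
    have : Injective (ModuleCat.of A A) := injective_iff_hasInjectiveDimensionLT_one.2 hd
    exact Module.Baer.of_injective (Module.injective_module_of_injective_object A A)
  | succ d ih =>
    refine ih ?_
    let 𝔪 := IsLocalRing.maximalIdeal A
    -- The socle element `s` embeds the residue field in `A`. Its `Ext` in degree `d + 1` lies
    -- between that of the projective module `A` and a group in degree `d + 2`, both zero.
    have hk : Subsingleton (Ext (ModuleCat.of A (A ⧸ 𝔪)) (ModuleCat.of A A) (d + 1)) := by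
      let I : Ideal A := Submodule.span A {s}
      let e : (A ⧸ 𝔪) ≃ₗ[A] I :=
        (Submodule.quotEquivOfEq _ _ hs.symm).trans (Ideal.quotTorsionOfEquivSpanSingleton A A s)
      have hS := shortExact_ideal_quotient I
      have hI : Subsingleton (Ext (ModuleCat.of A I) (ModuleCat.of A A) (d + 1)) := by
        refine ⟨fun x y => ?_⟩
        rw [← sub_eq_zero]
        obtain ⟨z, hz⟩ := Ext.contravariant_sequence_exact₁ hS (ModuleCat.of A A) (x - y)
          (add_comm 1 (d + 1)) (Ext.eq_zero_of_hasInjectiveDimensionLT _ (d + 1 + 1) le_rfl)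
        have : Projective (ModuleCat.of A A) := inferInstance
        rw [← hz]
        have hz0 : z = 0 := Ext.eq_zero_of_projective (P := ModuleCat.of A A) z
        rw [hz0, Ext.comp_zero]
      refine ⟨fun x y => ?_⟩
      have : ∀ x : Ext (ModuleCat.of A (A ⧸ 𝔪)) (ModuleCat.of A A) (d + 1), x = 0 := by
        intro x
        rw [← Ext.mk₀_id_comp x, ← e.toModuleIso.hom_inv_id, ← Ext.mk₀_comp_mk₀_assoc,
          hI.elim ((Ext.mk₀ e.toModuleIso.inv).comp x (zero_add _)) 0, Ext.comp_zero]
      rw [this x, this y]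
    refine hasInjectiveDimensionLT_of_subsingleton_ext_quotient d _ fun I => ?_
    -- Dévissage: `A ⧸ I` is filtered by quotients by primes, and the only prime is `𝔪`.
    refine IsNoetherianRing.induction_on_isQuotientEquivQuotientPrime A
      (M := A ⧸ I) inferInstance
      (motive := fun N _ _ _ => Subsingleton (Ext (ModuleCat.of A N) (ModuleCat.of A A) (d + 1)))
      ?_ ?_ ?_
    · intro N _ _ _ _
      have : ∀ x : Ext (ModuleCat.of A N) (ModuleCat.of A A) (d + 1), x = 0 := by
        intro x
        rw [← Ext.mk₀_id_comp x, (ModuleCat.isZero_of_subsingleton (ModuleCat.of A N)).eq_of_src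
          (𝟙 _) 0, Ext.mk₀_zero, Ext.zero_comp]
      exact ⟨fun x y => by rw [this x, this y]⟩
    · intro N _ _ _ p e
      have hp : p.1 = 𝔪 := IsLocalRing.eq_maximalIdeal (Ideal.IsPrime.isMaximal' (hI := p.2))
      let e' := e.trans (Submodule.quotEquivOfEq _ _ hp)
      have : ∀ x : Ext (ModuleCat.of A N) (ModuleCat.of A A) (d + 1), x = 0 := by
        intro x
        rw [← Ext.mk₀_id_comp x, ← e'.toModuleIso.hom_inv_id, ← Ext.mk₀_comp_mk₀_assoc,
          hk.elim ((Ext.mk₀ e'.toModuleIso.inv).comp x (zero_add _)) 0, Ext.comp_zero]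
      exact ⟨fun x y => by rw [this x, this y]⟩
    · intro N₁ _ _ _ N₂ _ _ _ N₃ _ _ _ f g hf hg hfg h₁ h₃
      have hS := ModuleCat.shortComplex_shortExact
        (ModuleCat.shortComplexOfCompEqZero f g hfg.linearMap_comp_eq_zero) hfg hf hg
      have : ∀ x : Ext (ModuleCat.of A N₂) (ModuleCat.of A A) (d + 1), x = 0 := by
        intro x
        obtain ⟨z, hz⟩ := Ext.contravariant_sequence_exact₂ hS (ModuleCat.of A A) x (h₁.elim _ _)
        rw [← hz, h₃.elim z 0, Ext.comp_zero]
      exact ⟨fun x y => by rw [this x, this y]⟩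

variable (K : Type*) [Field K] [Algebra K A]

/-- A Frobenius form on the `K`-algebra `A`. -/
def IsFrobeniusForm (ψ : A →ₗ[K] K) : Prop := ∀ x, (∀ y, ψ (x * y) = 0) → x = 0

variable {K}

theorem IsFrobeniusForm.bijective [FiniteDimensional K A] {ψ : A →ₗ[K] K}
    (h : IsFrobeniusForm K ψ) : Function.Bijective ((LinearMap.mul K A).compr₂ ψ) := by
  have hf : Function.Injective ((LinearMap.mul K A).compr₂ ψ) := by
    rw [← LinearMap.ker_eq_bot, LinearMap.ker_eq_bot']
    exact fun x hx => h x fun y => LinearMap.congr_fun hx y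
  exact ⟨hf, (LinearMap.injective_iff_surjective_of_finrank_eq_finrank
    (Subspace.dual_finrank_eq (K := K) (V := A)).symm).1 hf⟩

theorem IsFrobeniusForm.exists_apply_eq [FiniteDimensional K A] {ψ : A →ₗ[K] K}
    (h : IsFrobeniusForm K ψ) (φ : A →ₗ[K] K) : ∃ z, ∀ y, φ y = ψ (z * y) := by
  obtain ⟨z, hz⟩ := h.bijective.2 φ
  exact ⟨z, fun y => (LinearMap.congr_fun hz y).symm⟩

/-- Over a field `ψ ∘ g` extends from the ideal to all of `A`. Nondegeneracy writes the extension as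
`ψ (z * ·)`, and multiplication by `z` extends `g`. -/
theorem IsFrobeniusForm.baer [FiniteDimensional K A] {ψ : A →ₗ[K] K}
    (h : IsFrobeniusForm K ψ) : Module.Baer A A := by
  intro I g
  obtain ⟨φ, hφ⟩ := LinearMap.exists_extend (p := I.restrictScalars K)
    (ψ ∘ₗ (g.restrictScalars K))
  obtain ⟨z, hz⟩ := h.exists_apply_eq φ
  refine ⟨LinearMap.mulLeft A z, fun x hx => ?_⟩
  rw [← sub_eq_zero]
  refine h _ fun y => ?_
  have h1 : φ (x * y) = ψ (g ⟨x * y, I.mul_mem_right y hx⟩) :=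
    LinearMap.congr_fun hφ ⟨x * y, I.mul_mem_right y hx⟩
  have h2 : g ⟨x * y, I.mul_mem_right y hx⟩ = g ⟨x, hx⟩ * y := by
    calc g ⟨x * y, I.mul_mem_right y hx⟩ = g (y • ⟨x, hx⟩) :=
          congrArg g (Subtype.ext (mul_comm x y))
      _ = g ⟨x, hx⟩ * y := by rw [map_smul, smul_eq_mul, mul_comm]
  rw [LinearMap.mulLeft_apply, sub_mul, map_sub, mul_assoc, ← hz, h1, h2, sub_self]

theorem IsLocalRing.isNilpotent_of_not_isUnit [IsLocalRing A] [IsArtinianRing A] {x : A}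
    (hx : ¬ IsUnit x) : IsNilpotent x := by
  obtain ⟨n, hn⟩ := IsArtinianRing.isNilpotent_jacobson_bot (R := A)
  rw [IsLocalRing.jacobson_eq_maximalIdeal ⊥ bot_ne_top] at hn
  have := Ideal.pow_mem_pow ((IsLocalRing.mem_maximalIdeal x).2 hx) n
  rw [hn] at this
  exact ⟨n, by simpa using this⟩

/-- Every nonzero element of a local Artinian ring has a multiple in the socle. -/
theorem exists_torsionOf_eq_maximalIdeal [IsLocalRing A] [IsArtinianRing A] (x : A) (hx : x ≠ 0) :
    ∃ r : A, Ideal.torsionOf A A (r * x) = IsLocalRing.maximalIdeal A := by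
  -- Induction on the power of the maximal ideal that kills `x`.
  have key : ∀ (n : ℕ) (x : A), x ≠ 0 → (∀ a ∈ IsLocalRing.maximalIdeal A ^ n, a * x = 0) →
      ∃ r : A, Ideal.torsionOf A A (r * x) = IsLocalRing.maximalIdeal A := by
    intro n
    induction n with
    | zero => exact fun x hx h => absurd (by simpa using h 1 (by simp)) hx
    | succ n ih =>
      intro x hx h
      by_cases hm : ∀ a ∈ IsLocalRing.maximalIdeal A, a * x = 0
      · refine ⟨1, ((IsLocalRing.maximalIdeal.isMaximal A).eq_of_le ?_ ?_).symm⟩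
        · rw [Ideal.ne_top_iff_one, Ideal.mem_torsionOf_iff]
          simpa using hx
        · intro a ha
          rw [Ideal.mem_torsionOf_iff]
          simpa using hm a ha
      · push Not at hm
        obtain ⟨a, ha, hax⟩ := hm
        obtain ⟨r, hr⟩ := ih (a * x) hax fun b hb => by
          rw [← mul_assoc]
          exact h _ (pow_succ (IsLocalRing.maximalIdeal A) n ▸ Ideal.mul_mem_mul hb ha)
        exact ⟨r * a, by rw [mul_assoc, hr]⟩
  obtain ⟨n, hn⟩ := IsArtinianRing.isNilpotent_jacobson_bot (R := A)
  rw [IsLocalRing.jacobson_eq_maximalIdeal ⊥ bot_ne_top] at hn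
  exact key n x hx fun a ha => by
    rw [hn] at ha
    rw [show a = 0 by simpa using ha, zero_mul]

/-- Equal annihilators give isomorphic principal ideals. Self-injectivity extends the isomorphism to
`A`, where it is multiplication by its value at `1`. -/
theorem exists_mul_eq_of_baer (h : Module.Baer A A) {s s' : A}
    (hs : Ideal.torsionOf A A s = Ideal.torsionOf A A s') : ∃ z, z * s = s' := by
  let e := ((Ideal.quotTorsionOfEquivSpanSingleton A A s).symm.trans
    (Submodule.quotEquivOfEq _ _ hs)).trans (Ideal.quotTorsionOfEquivSpanSingleton A A s')
  have he : e ⟨s, Submodule.mem_span_singleton_self s⟩ =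
      ⟨s', Submodule.mem_span_singleton_self s'⟩ := by
    have h1 : (Ideal.quotTorsionOfEquivSpanSingleton A A s).symm
        ⟨s, Submodule.mem_span_singleton_self s⟩ = Submodule.Quotient.mk 1 := by
      rw [LinearEquiv.symm_apply_eq]
      apply Subtype.ext
      exact (one_smul A s).symm
    simp only [e, LinearEquiv.trans_apply, h1, Submodule.quotEquivOfEq_mk]
    apply Subtype.ext
    exact one_smul A s'
  obtain ⟨g, hg⟩ := h (Submodule.span A {s}) (Submodule.subtype _ ∘ₗ e.toLinearMap)
  refine ⟨g 1, ?_⟩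
  have := hg s (Submodule.mem_span_singleton_self s)
  rw [LinearMap.comp_apply, LinearEquiv.coe_coe, he] at this
  rw [mul_comm, ← smul_eq_mul, ← map_smul, smul_eq_mul, mul_one, this]
  rfl

/-- Any functional not vanishing on one socle generator `r` works: each nonzero `x` has a nonzero
socle multiple, which in turn has `r` as a multiple. -/
theorem exists_isFrobeniusForm_of_baer [IsLocalRing A] [FiniteDimensional K A]
    (h : Module.Baer A A) : ∃ ψ : A →ₗ[K] K, IsFrobeniusForm K ψ := by
  have : IsArtinianRing A := IsArtinianRing.of_finite K A
  obtain ⟨r, hr⟩ := exists_torsionOf_eq_maximalIdeal (1 : A) one_ne_zero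
  rw [mul_one] at hr
  have hr0 : r ≠ 0 := by
    rintro rfl
    refine (Ideal.ne_top_iff_one _).1 (IsLocalRing.maximalIdeal.isMaximal A).ne_top ?_
    rw [← hr, Ideal.mem_torsionOf_iff, smul_zero]
  obtain ⟨ψ, hψ⟩ : ∃ ψ : Module.Dual K A, ψ r ≠ 0 := by
    by_contra! hall
    exact hr0 ((Module.forall_dual_apply_eq_zero_iff K r).1 hall)
  refine ⟨ψ, fun x hx => ?_⟩
  by_contra hx0
  obtain ⟨a, ha⟩ := exists_torsionOf_eq_maximalIdeal x hx0
  obtain ⟨z, hz⟩ := exists_mul_eq_of_baer h (s := a * x) (s' := r) (ha.trans hr.symm)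
  exact hψ (by rw [← hz, ← hx (z * a)]; congr 1; ring)

theorem isGorensteinLocalRing_iff [IsLocalRing A] [FiniteDimensional K A] :
    IsGorensteinLocalRing A ↔ ∃ ψ : A →ₗ[K] K, IsFrobeniusForm K ψ := by
  have : IsArtinianRing A := IsArtinianRing.of_finite K A
  constructor
  · rintro ⟨-, -, d, hd⟩
    obtain ⟨r, hr⟩ := exists_torsionOf_eq_maximalIdeal (1 : A) one_ne_zero
    exact exists_isFrobeniusForm_of_baer (baer_self_of_hasInjectiveDimensionLE hr d hd)
  · rintro ⟨ψ, hψ⟩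
    refine ⟨inferInstance, inferInstance, 0, ?_⟩
    have : Module.Injective A A := hψ.baer.injective
    exact injective_iff_hasInjectiveDimensionLT_one.1
      (Module.injective_object_of_injective_module A A)

end Gorenstein

/-! ### The Noether different and direct factors. -/

section NoetherDifferent

variable {A B : Type*} [CommRing A] [CommRing B] [Algebra A B]

theorem mem_annihilator_kaehlerIdeal_iff (t : B ⊗[A] B) :
    t ∈ (KaehlerDifferential.ideal A B).annihilator ↔
      ∀ y : B, (y ⊗ₜ[A] (1 : B)) * t = ((1 : B) ⊗ₜ[A] y) * t := by
  rw [Submodule.mem_annihilator]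
  constructor
  · intro h y
    have := h _ (KaehlerDifferential.one_smul_sub_smul_one_mem_ideal A y)
    rw [smul_eq_mul, mul_sub, sub_eq_zero] at this
    rw [mul_comm, mul_comm _ t, this]
  · intro h n hn
    rw [← KaehlerDifferential.span_range_eq_ideal] at hn
    induction hn using Submodule.span_induction with
    | mem x hx =>
      obtain ⟨y, rfl⟩ := hx
      dsimp only
      rw [smul_eq_mul, mul_sub, mul_comm t, mul_comm t, h y, sub_self]
    | zero => simp
    | add x y _ _ hx hy => rw [smul_add, hx, hy, add_zero]
    | smul a x _ hx => rw [smul_comm, hx, smul_zero]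

theorem mem_noetherDifferentIdeal_iff (x : B) :
    x ∈ noetherDifferentIdeal A B ↔ ∃ t : B ⊗[A] B,
      (∀ y : B, (y ⊗ₜ[A] (1 : B)) * t = ((1 : B) ⊗ₜ[A] y) * t) ∧
        Algebra.TensorProduct.lmul' A t = x := by
  have hsurj : Function.Surjective (Algebra.TensorProduct.lmul' A : B ⊗[A] B →ₐ[A] B) :=
    fun b => ⟨b ⊗ₜ 1, by simp⟩
  simp_rw [← mem_annihilator_kaehlerIdeal_iff]
  exact Ideal.mem_map_iff_of_surjective _ hsurj

/-- The Noether different of a quotient by a direct factor. -/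
theorem map_noetherDifferentIdeal_of_section {T : Type*} [CommRing T] [Algebra A T]
    (π : B →ₐ[A] T) (ι : T →ₗ[A] B) (hι : ∀ s t, ι (π s * t) = s * ι t) (hπ : ∀ t, π (ι t) = t)
    (x : T) : x ∈ noetherDifferentIdeal A T ↔ ∃ u ∈ noetherDifferentIdeal A B, π u = x := by
  rw [mem_noetherDifferentIdeal_iff]
  constructor
  · rintro ⟨t, ht, rfl⟩
    -- `ι` is `B`-linear though not unital, which suffices to transport the annihilator condition.
    let F : T ⊗[A] T →ₗ[A] B ⊗[A] B := TensorProduct.map ι ι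
    have hl : ∀ (y : B) (t : T ⊗[A] T), F ((π y ⊗ₜ 1) * t) = (y ⊗ₜ 1) * F t := by
      intro y t
      induction t with
      | zero => simp
      | add t u ht hu => rw [mul_add, map_add, map_add, mul_add, ht, hu]
      | tmul a c => simp [F, hι]
    have hr : ∀ (y : B) (t : T ⊗[A] T), F ((1 ⊗ₜ π y) * t) = (1 ⊗ₜ y) * F t := by
      intro y t
      induction t with
      | zero => simp
      | add t u ht hu => rw [mul_add, map_add, map_add, mul_add, ht, hu]
      | tmul a c => simp [F, hι]
    have hμ : ∀ t : T ⊗[A] T, π (Algebra.TensorProduct.lmul' A (F t)) =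
        Algebra.TensorProduct.lmul' A t := by
      intro t
      induction t with
      | zero => simp
      | add t u ht hu => rw [map_add, map_add, map_add, map_add, ht, hu]
      | tmul a c => simp [F, hπ]
    exact ⟨_, (mem_noetherDifferentIdeal_iff _).2
      ⟨F t, fun y => by rw [← hl, ← hr, ht], rfl⟩, hμ t⟩
  · rintro ⟨u, hu, rfl⟩
    obtain ⟨t, ht, rfl⟩ := (mem_noetherDifferentIdeal_iff u).1 hu
    refine ⟨Algebra.TensorProduct.map π π t, fun y => ?_, ?_⟩
    · have := congrArg (Algebra.TensorProduct.map π π) (ht (ι y))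
      simpa only [map_mul, Algebra.TensorProduct.map_tmul, hπ, map_one] using this
    · clear ht hu
      induction t with
      | zero => simp
      | add t u ht hu => rw [map_add, map_add, map_add, map_add, ht, hu]
      | tmul a c => simp

end NoetherDifferent

/-! ### Trace computations and the different of a local algebra. -/

section Local

universe u

variable {K : Type*} [Field K] {S : Type u} [CommRing S] [Algebra K S]

/-- The `K`-linear endomorphism `y ↦ ∑ σ (aᵢ y) cᵢ` attached to `∑ aᵢ ⊗ cᵢ`. -/
def contractEnd (σ : S →ₗ[K] K) : S ⊗[K] S →ₗ[K] Module.End K S :=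
  dualTensorHom K S S ∘ₗ LinearMap.rTensor S ((LinearMap.mul K S).compr₂ σ)

theorem contractEnd_tmul (σ : S →ₗ[K] K) (a c y : S) :
    contractEnd σ (a ⊗ₜ c) y = σ (a * y) • c := by
  simp [contractEnd]

theorem contractEnd_left_mul (σ : S →ₗ[K] K) (t : S ⊗[K] S) (y z : S) :
    contractEnd σ ((y ⊗ₜ 1) * t) z = contractEnd σ t (y * z) := by
  induction t with
  | zero => simp
  | add t u ht hu => rw [mul_add, map_add, map_add, LinearMap.add_apply, LinearMap.add_apply, ht, hu]
  | tmul a c =>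
    rw [Algebra.TensorProduct.tmul_mul_tmul, contractEnd_tmul, contractEnd_tmul, one_mul]
    congr 2
    ring

theorem contractEnd_right_mul (σ : S →ₗ[K] K) (t : S ⊗[K] S) (y z : S) :
    contractEnd σ ((1 ⊗ₜ y) * t) z = y * contractEnd σ t z := by
  induction t with
  | zero => simp
  | add t u ht hu =>
    rw [mul_add, map_add, map_add, LinearMap.add_apply, LinearMap.add_apply, ht, hu, mul_add]
  | tmul a c =>
    rw [Algebra.TensorProduct.tmul_mul_tmul, contractEnd_tmul, contractEnd_tmul, one_mul,
      mul_smul_comm]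

theorem contractEnd_eq_zero_of_forall (σ : S →ₗ[K] K) (t : S ⊗[K] S) (x : S)
    (hx : ∀ y, σ (x * y) = 0) : contractEnd σ t x = 0 := by
  induction t with
  | zero => simp
  | add t u ht hu => rw [map_add, LinearMap.add_apply, ht, hu, add_zero]
  | tmul a c => rw [contractEnd_tmul, mul_comm, hx, zero_smul]

variable [FiniteDimensional K S]

theorem trace_contractEnd (σ : S →ₗ[K] K) (t : S ⊗[K] S) :
    LinearMap.trace K S (contractEnd σ t) = σ (Algebra.TensorProduct.lmul' K t) := by
  induction t with
  | zero => simp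
  | add t u ht hu => rw [map_add, map_add, map_add, map_add, ht, hu]
  | tmul a c =>
    simp [contractEnd]

omit [FiniteDimensional K S] in
-- The condition on `t` makes the contracted endomorphism `S`-linear.
theorem contractEnd_eq_lmul (σ : S →ₗ[K] K) (t : S ⊗[K] S)
    (ht : ∀ y : S, (y ⊗ₜ[K] (1 : S)) * t = ((1 : S) ⊗ₜ[K] y) * t) :
    contractEnd σ t = Algebra.lmul K S (contractEnd σ t 1) := by
  ext y
  have := contractEnd_left_mul σ t y 1
  rw [ht, contractEnd_right_mul, mul_one] at this
  rw [← this, mul_comm]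
  rfl

theorem apply_lmul'_eq_trace (σ : S →ₗ[K] K) (t : S ⊗[K] S)
    (ht : ∀ y : S, (y ⊗ₜ[K] (1 : S)) * t = ((1 : S) ⊗ₜ[K] y) * t) :
    σ (Algebra.TensorProduct.lmul' K t) = Algebra.trace K S (contractEnd σ t 1) := by
  rw [← trace_contractEnd, Algebra.trace_apply, ← contractEnd_eq_lmul σ t ht]

/-- Nilpotent elements annihilate the Noether different. -/
theorem mul_eq_zero_of_mem_noetherDifferentIdeal {x y : S}
    (hx : x ∈ noetherDifferentIdeal K S) (hy : IsNilpotent y) : y * x = 0 := by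
  obtain ⟨t, ht, rfl⟩ := (mem_noetherDifferentIdeal_iff x).1 hx
  rw [← Module.forall_dual_apply_eq_zero_iff K]
  intro σ
  -- Multiplying `t` by `1 ⊗ y` multiplies the element under the trace by the nilpotent `y`.
  have h := apply_lmul'_eq_trace σ ((1 ⊗ₜ y) * t) fun z => by
    rw [mul_left_comm, ht, mul_left_comm]
  rw [map_mul, Algebra.TensorProduct.lmul'_apply_tmul, one_mul, contractEnd_right_mul] at h
  rw [h]
  exact (Algebra.isNilpotent_trace_of_isNilpotent
    (((Commute.all _ _).isNilpotent_mul_right hy))).eq_zero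

/-- If `contractEnd σ t 1` were a unit, `σ` would be a Frobenius form, since any `x` in the radical
of `σ` is killed by that unit. -/
theorem noetherDifferentIdeal_eq_bot [IsLocalRing S]
    (h : ¬ ∃ ψ : S →ₗ[K] K, IsFrobeniusForm K ψ) : noetherDifferentIdeal K S = ⊥ := by
  have : IsArtinianRing S := IsArtinianRing.of_finite K S
  rw [eq_bot_iff]
  intro x hx
  obtain ⟨t, ht, rfl⟩ := (mem_noetherDifferentIdeal_iff x).1 hx
  rw [Ideal.mem_bot, ← Module.forall_dual_apply_eq_zero_iff K]
  intro σ
  rw [apply_lmul'_eq_trace σ t ht]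
  refine (Algebra.isNilpotent_trace_of_isNilpotent
    (IsLocalRing.isNilpotent_of_not_isUnit fun hu => ?_)).eq_zero
  refine h ⟨σ, fun x hx => ?_⟩
  have h1 := contractEnd_eq_zero_of_forall σ t x hx
  rw [contractEnd_eq_lmul σ t ht] at h1
  exact (hu.mul_right_eq_zero).1 h1

/-- Nondegeneracy makes `contractEnd ψ` bijective. The preimage of the identity inherits the
annihilator condition from the `S`-linearity of the identity. -/
theorem IsFrobeniusForm.exists_casimir {ψ : S →ₗ[K] K} (h : IsFrobeniusForm K ψ) :
    ∃ t : S ⊗[K] S, (∀ y : S, (y ⊗ₜ[K] (1 : S)) * t = ((1 : S) ⊗ₜ[K] y) * t) ∧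
      contractEnd ψ t = LinearMap.id := by
  have hinj : Function.Bijective (contractEnd ψ) := by
    have h2 : Function.Bijective (dualTensorHom K S S) := (dualTensorHomEquiv K S S).bijective
    refine h2.comp ?_
    exact ((LinearEquiv.ofBijective _ h.bijective).rTensor S).bijective
  obtain ⟨t, ht⟩ := hinj.2 LinearMap.id
  refine ⟨t, fun y => hinj.1 ?_, ht⟩
  ext z
  rw [contractEnd_left_mul, contractEnd_right_mul, ht]
  rfl

theorem finrank_noetherDifferentIdeal_of_isLocalRing [IsLocalRing S]
    {ψ : S →ₗ[K] K} (h : IsFrobeniusForm K ψ)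
    (hdim : (Module.finrank K S : K) ≠ 0) :
    Module.finrank K ((noetherDifferentIdeal K S).restrictScalars K) =
      Module.finrank K (IsLocalRing.ResidueField S) := by
  have : IsArtinianRing S := IsArtinianRing.of_finite K S
  have htors : ∀ x ∈ noetherDifferentIdeal K S, x ≠ 0 →
      Ideal.torsionOf S S x = IsLocalRing.maximalIdeal S := by
    intro x hx hx0
    refine ((IsLocalRing.maximalIdeal.isMaximal S).eq_of_le ?_ ?_).symm
    · rw [Ideal.ne_top_iff_one, Ideal.mem_torsionOf_iff]
      simpa using hx0
    · intro a ha
      rw [Ideal.mem_torsionOf_iff]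
      exact mul_eq_zero_of_mem_noetherDifferentIdeal hx
        (IsLocalRing.isNilpotent_of_not_isUnit ((IsLocalRing.mem_maximalIdeal a).1 ha))
  obtain ⟨t, ht, hψt⟩ := h.exists_casimir
  set δ := Algebra.TensorProduct.lmul' K t with hδ
  have hδmem : δ ∈ noetherDifferentIdeal K S := (mem_noetherDifferentIdeal_iff δ).2 ⟨t, ht, rfl⟩
  -- `ψ δ` is the trace of the identity, that is, the dimension of `S` in `K`.
  have hδ0 : δ ≠ 0 := by
    intro h0
    have := trace_contractEnd ψ t
    rw [hψt, ← hδ, h0, map_zero, LinearMap.trace_id] at this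
    exact hdim this
  have hspan : noetherDifferentIdeal K S = Submodule.span S {δ} := by
    refine le_antisymm (fun x hx => ?_) ?_
    · by_cases hx0 : x = 0
      · rw [hx0]
        exact zero_mem _
      obtain ⟨z, rfl⟩ := exists_mul_eq_of_baer h.baer
        ((htors δ hδmem hδ0).trans (htors x hx hx0).symm)
      exact Submodule.mem_span_singleton.2 ⟨z, rfl⟩
    · rw [Submodule.span_singleton_le_iff_mem]
      exact hδmem
  rw [hspan]
  let e : (S ⧸ IsLocalRing.maximalIdeal S) ≃ₗ[S] Submodule.span S {δ} :=
    (Submodule.quotEquivOfEq _ _ (htors δ hδmem hδ0).symm).trans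
      (Ideal.quotTorsionOfEquivSpanSingleton S S δ)
  exact (e.restrictScalars K).finrank_eq.symm

end Local

/-! ### Decomposition of `S` into its local rings. -/

section Product

variable {K : Type*} [Field K] {S : Type*} [CommRing S] [Algebra K S] [FiniteDimensional K S]

/-- `ι` includes the factor at `p` into the Artinian ring `S`, the product of its localizations. -/
theorem exists_section_localization (p : MaximalSpectrum S) [DecidableEq (MaximalSpectrum S)] :
    ∃ ι : Localization.AtPrime p.asIdeal →ₗ[K] S,
      (∀ s t, ι (algebraMap S _ s * t) = s * ι t) ∧
      ∀ (q : MaximalSpectrum S) t, algebraMap S (Localization.AtPrime q.asIdeal) (ι t) =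
        (Pi.single p t : MaximalSpectrum.PiLocalization S) q := by
  have : IsArtinianRing S := IsArtinianRing.of_finite K S
  let E := MaximalSpectrum.toPiLocalizationEquiv S
  let ι : Localization.AtPrime p.asIdeal →ₗ[K] S :=
    ((E.symm.toLinearEquiv.restrictScalars K).toLinearMap :
      (∀ q : MaximalSpectrum S, Localization.AtPrime q.asIdeal) →ₗ[K] S) ∘ₗ
      LinearMap.single K (fun q : MaximalSpectrum S => Localization.AtPrime q.asIdeal) p
  have hq : ∀ (q : MaximalSpectrum S) t, algebraMap S (Localization.AtPrime q.asIdeal) (ι t) =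
        (Pi.single p t : MaximalSpectrum.PiLocalization S) q := fun q t =>
    congrFun (E.apply_symm_apply (Pi.single p t)) q
  clear_value ι
  refine ⟨ι, fun s t => ?_, hq⟩
  apply MaximalSpectrum.toPiLocalization_injective S
  funext q
  change algebraMap S (Localization.AtPrime q.asIdeal) (ι (algebraMap S _ s * t)) =
    algebraMap S (Localization.AtPrime q.asIdeal) (s * ι t)
  rw [hq, map_mul, hq]
  obtain rfl | hpq := eq_or_ne q p
  · simp
  · rw [Pi.single_eq_of_ne hpq, Pi.single_eq_of_ne hpq, mul_zero]

instance finiteDimensional_localization (p : MaximalSpectrum S) :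
    FiniteDimensional K (Localization.AtPrime p.asIdeal) := by
  classical
  obtain ⟨ι, -, h⟩ := exists_section_localization (K := K) p
  refine Module.Finite.of_injective ι fun a b hab => ?_
  have := congrArg (algebraMap S (Localization.AtPrime p.asIdeal)) hab
  simpa [h] using this

theorem finrank_noetherDifferentIdeal_eq_sum [Fintype (MaximalSpectrum S)] :
    Module.finrank K ((noetherDifferentIdeal K S).restrictScalars K) =
      ∑ p : MaximalSpectrum S, Module.finrank K
        ((noetherDifferentIdeal K (Localization.AtPrime p.asIdeal)).restrictScalars K) := by
  classical
  choose ι hι hq using exists_section_localization (K := K) (S := S)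
  have hsec : ∀ (p : MaximalSpectrum S) t,
      algebraMap S (Localization.AtPrime p.asIdeal) (ι p t) = t := fun p t => by simp [hq]
  have hmem : ∀ (p : MaximalSpectrum S) (x : Localization.AtPrime p.asIdeal),
      x ∈ noetherDifferentIdeal K (Localization.AtPrime p.asIdeal) ↔
      ∃ u ∈ noetherDifferentIdeal K S, algebraMap S _ u = x := fun p x =>
    map_noetherDifferentIdeal_of_section (IsScalarTower.toAlgHom K S _) (ι p) (hι p) (hsec p) x
  rw [← Module.finrank_pi_fintype]
  let f : (noetherDifferentIdeal K S).restrictScalars K →ₗ[K] ∀ p : MaximalSpectrum S,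
      (noetherDifferentIdeal K (Localization.AtPrime p.asIdeal)).restrictScalars K :=
    LinearMap.pi fun p => (IsScalarTower.toAlgHom K S
      (Localization.AtPrime p.asIdeal)).toLinearMap.restrict fun u hu => (hmem p _).2 ⟨u, hu, rfl⟩
  refine (LinearEquiv.ofBijective f ⟨fun u v huv => ?_, fun v => ?_⟩).finrank_eq
  · apply Subtype.ext
    apply MaximalSpectrum.toPiLocalization_injective S
    funext p
    exact congrArg Subtype.val (congrFun huv p)
  · choose u hu huv using fun p => (hmem p _).1 (v p).2
    -- The elements `ι p 1` are the orthogonal idempotents, gluing the local lifts `u p`.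
    refine ⟨⟨∑ p, ι p 1 * u p, sum_mem fun p _ => Ideal.mul_mem_left _ _ (hu p)⟩, ?_⟩
    funext q
    apply Subtype.ext
    change algebraMap S (Localization.AtPrime q.asIdeal) (∑ p, ι p 1 * u p) = _
    rw [map_sum, Finset.sum_eq_single q]
    · rw [map_mul, hsec, huv, one_mul]
    · intro p _ hp
      rw [map_mul, hq, Pi.single_eq_of_ne hp.symm, zero_mul]
    · simp

theorem finrank_localization_le (p : MaximalSpectrum S) :
    Module.finrank K (Localization.AtPrime p.asIdeal) ≤ Module.finrank K S := by
  classical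
  obtain ⟨ι, -, h⟩ := exists_section_localization (K := K) p
  refine LinearMap.finrank_le_finrank_of_injective (f := ι) fun a b hab => ?_
  have := congrArg (algebraMap S (Localization.AtPrime p.asIdeal)) hab
  simpa [h] using this

open Classical in
theorem finrank_noetherDifferentIdeal [Fintype (MaximalSpectrum S)]
    (hchar : ringChar K = 0 ∨ Module.finrank K S < ringChar K) :
    Module.finrank K ((noetherDifferentIdeal K S).restrictScalars K) =
      ∑ p : MaximalSpectrum S, if IsGorensteinLocalRing (Localization.AtPrime p.asIdeal) then
        Module.finrank K (IsLocalRing.ResidueField (Localization.AtPrime p.asIdeal)) else 0 := by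
  rw [finrank_noetherDifferentIdeal_eq_sum]
  refine Finset.sum_congr rfl fun p _ => ?_
  -- The local dimension is positive and at most `dim S`, hence not divisible by the characteristic.
  have hdim : (Module.finrank K (Localization.AtPrime p.asIdeal) : K) ≠ 0 := by
    have hpos : 0 < Module.finrank K (Localization.AtPrime p.asIdeal) := Module.finrank_pos
    rw [Ne, ringChar.spec]
    intro hdvd
    have := Nat.le_of_dvd hpos hdvd
    have := finrank_localization_le (K := K) p
    rcases hchar with h | h
    · rw [h, zero_dvd_iff] at hdvd
      omega
    · omega
  split_ifs with hG
  · obtain ⟨ψ, hψ⟩ := (isGorensteinLocalRing_iff (K := K)).1 hG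
    exact finrank_noetherDifferentIdeal_of_isLocalRing hψ hdim
  · rw [noetherDifferentIdeal_eq_bot fun h => hG ((isGorensteinLocalRing_iff (K := K)).2 h), Submodule.restrictScalars_bot]
    exact finrank_bot K _

end Product

/-! ### The graded ring `R` in large degrees. -/

theorem MvPolynomial.homogeneousComponent_succ_X_mul {σ R : Type*} [CommSemiring R] (j : σ) (i : ℕ)
    (f : MvPolynomial σ R) :
    homogeneousComponent (i + 1) (X j * f) = X j * homogeneousComponent i f := by
  induction f using MvPolynomial.induction_on' with
  | monomial d a =>
    have h1 : monomial d a ∈ homogeneousSubmodule σ R d.degree := isHomogeneous_monomial a rfl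
    have h2 : X j * monomial d a ∈ homogeneousSubmodule σ R (1 + d.degree) :=
      (isHomogeneous_X R j).mul (isHomogeneous_monomial a rfl)
    rw [homogeneousComponent_of_mem h1, homogeneousComponent_of_mem h2]
    by_cases h : d.degree = i
    · rw [if_pos (by omega), if_pos (by omega)]
    · rw [if_neg (by omega), if_neg (by omega), mul_zero]
  | add p q hp hq => rw [mul_add, map_add, map_add, mul_add, hp, hq]

theorem MvPolynomial.homogeneousComponent_zero_X_mul {σ R : Type*} [CommSemiring R] (j : σ)
    (f : MvPolynomial σ R) : homogeneousComponent 0 (X j * f) = 0 := by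
  classical
  rw [homogeneousComponent_zero, coeff_X_mul']
  simp

namespace ZeroDimSubscheme

open MvPolynomial

variable {K : Type*} [Field K] {n : ℕ} (X : ZeroDimSubscheme K n)

/-- A homogeneous prime over `I + (X₀)` missing some `X_j` would be a point of the subscheme on the
hyperplane, so every `X_j` lies in the radical. -/
theorem exists_pow_mem (hX : X.AvoidsHyperplane) :
    ∃ N : ℕ, ∀ j, (MvPolynomial.X j : MvPolynomial (Fin (n + 1)) K) ^ N ∈
      X.vanishingIdeal ⊔ Ideal.span {MvPolynomial.X 0} := by
  set J := X.vanishingIdeal ⊔ Ideal.span {(MvPolynomial.X 0 : MvPolynomial (Fin (n + 1)) K)}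
  have hJ : J.IsHomogeneous (homogeneousSubmodule (Fin (n + 1)) K) := by
    refine X.isHomogeneous.sup (Ideal.homogeneous_span _ _ ?_)
    rintro _ rfl
    exact ⟨1, isHomogeneous_X K 0⟩
  have hrad : ∀ j, (MvPolynomial.X j : MvPolynomial (Fin (n + 1)) K) ∈ J.radical := by
    intro j
    rw [hJ.radical_eq, Submodule.mem_sInf]
    rintro P ⟨hP, hJP, hprime⟩
    by_contra hj
    let x : ProjectiveSpectrum (homogeneousSubmodule (Fin (n + 1)) K) :=
      ⟨⟨P, hP⟩, hprime, fun hirr => hj (hirr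
        (HomogeneousIdeal.mem_irrelevant_of_mem _ one_pos (isHomogeneous_X K j)))⟩
    have hx : x ∈ X.support ∩ ProjectiveSpectrum.zeroLocus _ {MvPolynomial.X 0} := by
      refine ⟨?_, ?_⟩
      · exact fun f hf => hJP (Ideal.mem_sup_left hf)
      · rintro _ rfl
        exact hJP (Ideal.mem_sup_right (Ideal.mem_span_singleton_self _))
    rw [AvoidsHyperplane] at hX
    rw [hX] at hx
    exact hx
  choose N hN using hrad
  exact ⟨∑ j, N j, fun j => Ideal.pow_mem_of_pow_mem _ (hN j)
    (Finset.single_le_sum (f := N) (fun _ _ => Nat.zero_le _) (Finset.mem_univ j))⟩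

/-- `X₀` is a nonzerodivisor modulo the vanishing ideal. -/
theorem mem_of_X_zero_mul_mem (hX : X.AvoidsHyperplane) {f : MvPolynomial (Fin (n + 1)) K}
    (hf : MvPolynomial.X 0 * f ∈ X.vanishingIdeal) : f ∈ X.vanishingIdeal := by
  obtain ⟨N, hN⟩ := X.exists_pow_mem hX
  refine X.isSaturated N f fun j => ?_
  obtain ⟨a, ha, b, hb, hab⟩ := Submodule.mem_sup.1 (hN j)
  obtain ⟨c, rfl⟩ := Ideal.mem_span_singleton.1 hb
  rw [← hab, add_mul]
  refine add_mem (Ideal.mul_mem_right _ _ ha) ?_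
  rw [mul_right_comm]
  exact Ideal.mul_mem_right _ _ hf

theorem mem_of_X_zero_pow_mul_mem (hX : X.AvoidsHyperplane) (k : ℕ)
    {f : MvPolynomial (Fin (n + 1)) K}
    (hf : MvPolynomial.X 0 ^ k * f ∈ X.vanishingIdeal) : f ∈ X.vanishingIdeal := by
  induction k with
  | zero => simpa using hf
  | succ k ih =>
    refine ih (X.mem_of_X_zero_mul_mem hX ?_)
    rwa [← mul_assoc, ← pow_succ']

/-- In large degrees, every form is a multiple of `X₀` modulo the vanishing ideal. -/
theorem exists_sub_X_zero_mul_mem (hX : X.AvoidsHyperplane) :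
    ∃ D : ℕ, ∀ i, D ≤ i → ∀ f : MvPolynomial (Fin (n + 1)) K, f.IsHomogeneous (i + 1) →
      ∃ g : MvPolynomial (Fin (n + 1)) K, g.IsHomogeneous i ∧
        f - MvPolynomial.X 0 * g ∈ X.vanishingIdeal := by
  obtain ⟨N, hN⟩ := X.exists_pow_mem hX
  -- Pigeonhole: a monomial of degree above `(n + 1) * N` has some exponent at least `N`.
  refine ⟨(n + 1) * N, fun i hi f hf => ?_⟩
  have hmem : f ∈ X.vanishingIdeal ⊔ Ideal.span {MvPolynomial.X 0} := by
    rw [f.as_sum]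
    refine sum_mem fun d hd => ?_
    have hdeg : d.degree = i + 1 := by
      by_contra h
      exact (mem_support_iff.1 hd) (hf.coeff_eq_zero h)
    obtain ⟨j, hj⟩ : ∃ j, N ≤ d j := by
      by_contra! h
      have h1 : d.degree ≤ ∑ _j : Fin (n + 1), N := by
        rw [Finsupp.degree_eq_sum]
        exact Finset.sum_le_sum fun j _ => (h j).le
      simp at h1
      omega
    rw [monomial_eq]
    refine Ideal.mul_mem_left _ _ ?_
    rw [Finsupp.prod_fintype _ _ (fun _ => pow_zero _), ← Finset.mul_prod_erase _ _
      (Finset.mem_univ j)]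
    exact Ideal.mul_mem_right _ _ (Ideal.pow_mem_of_pow_mem _ (hN j) hj)
  obtain ⟨a, ha, b, hb, rfl⟩ := Submodule.mem_sup.1 hmem
  obtain ⟨c, rfl⟩ := Ideal.mem_span_singleton.1 hb
  refine ⟨homogeneousComponent i c, homogeneousComponent_isHomogeneous i c, ?_⟩
  have h := homogeneousComponent_of_mem (m := i + 1) (n := i + 1) hf
  rw [if_pos rfl, map_add, homogeneousComponent_succ_X_mul] at h
  rw [← h, add_sub_cancel_right]
  exact homogeneousComponent_mem_of_mem X.isHomogeneous ha _

/-- The residue class map `R → S`. -/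
def toAffine : X.CoordRing →ₐ[K] X.AffineCoordRing :=
  Ideal.Quotient.mkₐ K (Ideal.span {X.x₀ - 1})

theorem toAffine_x₀ : X.toAffine X.x₀ = 1 := by
  rw [← sub_eq_zero, ← map_one X.toAffine, ← map_sub]
  exact Ideal.Quotient.eq_zero_iff_mem.2 (Ideal.mem_span_singleton_self _)

theorem toCoordRing_surjective : Function.Surjective X.toCoordRing :=
  Ideal.Quotient.mk_surjective

theorem toAffine_surjective : Function.Surjective X.toAffine :=
  Ideal.Quotient.mk_surjective

theorem toCoordRing_eq_zero_iff {f : MvPolynomial (Fin (n + 1)) K} :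
    X.toCoordRing f = 0 ↔ f ∈ X.vanishingIdeal :=
  Ideal.Quotient.eq_zero_iff_mem

/-- Write `f = (X₀ - 1) b` modulo the ideal and compare degrees: `b` vanishes below degree `i`, has
component `-f` in degree `i`, and component `X₀ ^ k * b_i` in degree `i + k`. The latter is zero for
large `k`, and `X₀` cancels. -/
theorem mem_vanishingIdeal_of_toAffine_eq_zero (hX : X.AvoidsHyperplane) {i : ℕ}
    {f : MvPolynomial (Fin (n + 1)) K} (hf : f.IsHomogeneous i)
    (h : X.toAffine (X.toCoordRing f) = 0) : f ∈ X.vanishingIdeal := by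
  obtain ⟨c, hc⟩ := Ideal.mem_span_singleton.1 (Ideal.Quotient.eq_zero_iff_mem.1 h)
  obtain ⟨b, rfl⟩ := X.toCoordRing_surjective c
  have hmem : f - (MvPolynomial.X 0 - 1) * b ∈ X.vanishingIdeal := by
    rw [← toCoordRing_eq_zero_iff, map_sub, map_mul, map_sub, map_one]
    exact sub_eq_zero.2 hc
  have hsucc : ∀ k, homogeneousComponent (k + 1) f - (MvPolynomial.X 0 * homogeneousComponent k b -
      homogeneousComponent (k + 1) b) ∈ X.vanishingIdeal := fun k => by
    have := homogeneousComponent_mem_of_mem X.isHomogeneous hmem (k + 1)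
    rwa [map_sub, sub_mul, one_mul, map_sub, homogeneousComponent_succ_X_mul] at this
  have hzero : homogeneousComponent 0 f + homogeneousComponent 0 b ∈ X.vanishingIdeal := by
    have := homogeneousComponent_mem_of_mem X.isHomogeneous hmem 0
    rwa [map_sub, sub_mul, one_mul, map_sub, homogeneousComponent_zero_X_mul, zero_sub,
      sub_neg_eq_add] at this
  have hcomp : ∀ k, homogeneousComponent k f = if k = i then f else 0 := fun k =>
    homogeneousComponent_of_mem hf
  have hlow : ∀ k, k < i → homogeneousComponent k b ∈ X.vanishingIdeal := by
    intro k
    induction k with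
    | zero =>
      intro hk
      rwa [hcomp, if_neg hk.ne, zero_add] at hzero
    | succ k ih =>
      intro hk
      have := hsucc k
      rw [hcomp, if_neg hk.ne, zero_sub, neg_sub] at this
      have h2 := add_mem this (Ideal.mul_mem_left _ (MvPolynomial.X 0) (ih (by omega)))
      rwa [sub_add_cancel] at h2
  have hi : f + homogeneousComponent i b ∈ X.vanishingIdeal := by
    cases i with
    | zero => rwa [hcomp, if_pos rfl] at hzero
    | succ i =>
      have := hsucc i
      rw [hcomp, if_pos rfl] at this
      have h2 := add_mem this (Ideal.mul_mem_left _ (MvPolynomial.X 0) (hlow i (by omega)))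
      convert h2 using 1
      ring
  have hhigh : ∀ k, homogeneousComponent (i + k) b -
      MvPolynomial.X 0 ^ k * homogeneousComponent i b ∈ X.vanishingIdeal := by
    intro k
    induction k with
    | zero => simp
    | succ k ih =>
      have := hsucc (i + k)
      rw [hcomp, if_neg (by omega)] at this
      have h2 := add_mem this (Ideal.mul_mem_left _ (MvPolynomial.X 0) ih)
      convert h2 using 1
      rw [← add_assoc]
      ring
  have hb : homogeneousComponent i b ∈ X.vanishingIdeal := by
    have := hhigh (b.totalDegree + 1)
    rw [homogeneousComponent_eq_zero _ _ (by omega), zero_sub, neg_mem_iff] at this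
    exact X.mem_of_X_zero_pow_mul_mem hX _ this
  rw [show f = f + homogeneousComponent i b - homogeneousComponent i b by ring]
  exact sub_mem hi hb

theorem exists_component_surjective (hX : X.AvoidsHyperplane) :
    ∃ D : ℕ, ∀ i, D ≤ i → ∀ s : X.AffineCoordRing, ∃ r ∈ X.component i, X.toAffine r = s := by
  obtain ⟨D, hD⟩ := X.exists_sub_X_zero_mul_mem hX
  refine ⟨D, fun i hi s => ?_⟩
  -- Forms of low degree are multiplied up by powers of `X₀`; those of high degree are divided by
  -- `X₀` modulo the ideal.
  have key : ∀ (j : ℕ) (f : MvPolynomial (Fin (n + 1)) K), f.IsHomogeneous j →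
      ∃ r ∈ X.component i, X.toAffine r = X.toAffine (X.toCoordRing f) := by
    intro j
    induction j with
    | zero =>
      intro f hf
      refine ⟨X.toCoordRing (MvPolynomial.X 0 ^ i * f), ⟨_, ?_, rfl⟩, ?_⟩
      · simpa using (isHomogeneous_X_pow (R := K) (0 : Fin (n + 1)) i).mul hf
      · have := X.toAffine_x₀
        rw [x₀] at this
        rw [map_mul, map_pow, map_mul, map_pow, this, one_pow, one_mul]
    | succ j ih =>
      intro f hf
      by_cases hj : i ≤ j
      · obtain ⟨g, hg, hfg⟩ := hD j (hi.trans hj) f hf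
        obtain ⟨r, hr, hrg⟩ := ih g hg
        refine ⟨r, hr, hrg.trans ?_⟩
        rw [← toCoordRing_eq_zero_iff, map_sub, sub_eq_zero, map_mul] at hfg
        have := X.toAffine_x₀
        rw [x₀] at this
        rw [hfg, map_mul, this, one_mul]
      · refine ⟨X.toCoordRing (MvPolynomial.X 0 ^ (i - (j + 1)) * f), ⟨_, ?_, rfl⟩, ?_⟩
        · have := (isHomogeneous_X_pow (R := K) (0 : Fin (n + 1)) (i - (j + 1))).mul hf
          rwa [Nat.sub_add_cancel (by omega)] at this
        · have := X.toAffine_x₀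
          rw [x₀] at this
          rw [map_mul, map_pow, map_mul, map_pow, this, one_pow, one_mul]
  obtain ⟨r, rfl⟩ := X.toAffine_surjective s
  obtain ⟨f, rfl⟩ := X.toCoordRing_surjective r
  choose g hg hgf using fun j => key j (homogeneousComponent j f)
    (homogeneousComponent_isHomogeneous j f)
  refine ⟨∑ j ∈ Finset.range (f.totalDegree + 1), g j, sum_mem fun j _ => hg j, ?_⟩
  rw [map_sum, Finset.sum_congr rfl fun j _ => hgf j, ← map_sum, ← map_sum,
    sum_homogeneousComponent]

theorem toAffine_injOn_component (hX : X.AvoidsHyperplane) {i : ℕ} {r : X.CoordRing}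
    (hr : r ∈ X.component i) (h : X.toAffine r = 0) : r = 0 := by
  obtain ⟨f, hf, rfl⟩ := hr
  exact X.toCoordRing_eq_zero_iff.2 (X.mem_vanishingIdeal_of_toAffine_eq_zero hX hf h)

instance (i : ℕ) : FiniteDimensional K (X.component i) :=
  Module.Finite.iff_fg.2 ((homogeneousSubmodule_fg (Fin (n + 1)) K i).map _)

theorem finiteDimensional_affineCoordRing (hX : X.AvoidsHyperplane) :
    FiniteDimensional K X.AffineCoordRing := by
  obtain ⟨D, hD⟩ := X.exists_component_surjective hX
  refine Module.Finite.of_surjective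
    (X.toAffine.toLinearMap ∘ₗ (X.component D).subtype) fun s => ?_
  obtain ⟨r, hr, rfl⟩ := hD D le_rfl s
  exact ⟨⟨r, hr⟩, rfl⟩

end ZeroDimSubscheme

/-! ### Comparison of the differents of `R/K[x₀]` and `S/K`. -/

namespace ZeroDimSubscheme

open MvPolynomial

variable {K : Type*} [Field K] {n : ℕ} (X : ZeroDimSubscheme K n)

theorem mul_mem_component {i j : ℕ} {r s : X.CoordRing} (hr : r ∈ X.component i)
    (hs : s ∈ X.component j) : r * s ∈ X.component (i + j) := by
  obtain ⟨f, hf, rfl⟩ := hr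
  obtain ⟨g, hg, rfl⟩ := hs
  exact ⟨f * g, IsHomogeneous.mul hf hg, map_mul X.toCoordRing f g⟩

theorem toCoordRing_X_mem_component (j : Fin (n + 1)) :
    X.toCoordRing (MvPolynomial.X j) ∈ X.component 1 :=
  ⟨_, isHomogeneous_X K j, rfl⟩

/-- The subring `K[x₀]` of `R`. -/
abbrev baseRing : Subalgebra K X.CoordRing := Algebra.adjoin K {X.x₀}

theorem toAffine_baseRing (a : X.baseRing) :
    ∃ c : K, X.toAffine (a : X.CoordRing) = algebraMap K _ c := by
  obtain ⟨a, ha⟩ := a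
  induction ha using Algebra.adjoin_induction with
  | mem x hx =>
    obtain rfl := hx
    exact ⟨1, by rw [X.toAffine_x₀, map_one]⟩
  | algebraMap c => exact ⟨c, X.toAffine.commutes c⟩
  | add x y _ _ hx hy =>
    obtain ⟨c, hc⟩ := hx
    obtain ⟨d, hd⟩ := hy
    exact ⟨c + d, by simp only [map_add, hc, hd]⟩
  | mul x y _ _ hx hy =>
    obtain ⟨c, hc⟩ := hx
    obtain ⟨d, hd⟩ := hy
    exact ⟨c * d, by simp only [map_mul, hc, hd]⟩

/-- The additive map `R ⊗_{K[x₀]} R → S ⊗_K S`. -/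
def tensorToAffine : X.CoordRing ⊗[X.baseRing] X.CoordRing →+
    X.AffineCoordRing ⊗[K] X.AffineCoordRing :=
  TensorProduct.liftAddHom
    { toFun := fun r =>
        { toFun := fun s => X.toAffine r ⊗ₜ[K] X.toAffine s
          map_zero' := by rw [map_zero, TensorProduct.tmul_zero]
          map_add' := fun a b => by rw [map_add, TensorProduct.tmul_add] }
      map_zero' := by
        ext s
        change X.toAffine 0 ⊗ₜ[K] X.toAffine s = 0
        rw [map_zero, TensorProduct.zero_tmul]
      map_add' := fun a b => by
        ext s
        change X.toAffine (a + b) ⊗ₜ[K] X.toAffine s =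
          X.toAffine a ⊗ₜ[K] X.toAffine s + X.toAffine b ⊗ₜ[K] X.toAffine s
        rw [map_add, TensorProduct.add_tmul] }
    (fun a r s => by
      change X.toAffine (a • r) ⊗ₜ[K] X.toAffine s = X.toAffine r ⊗ₜ[K] X.toAffine (a • s)
      obtain ⟨c, hc⟩ := X.toAffine_baseRing a
      rw [Subalgebra.smul_def, Subalgebra.smul_def, smul_eq_mul, smul_eq_mul, map_mul, map_mul,
        hc, ← Algebra.smul_def, ← Algebra.smul_def, TensorProduct.smul_tmul])

theorem tensorToAffine_tmul (r s : X.CoordRing) :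
    X.tensorToAffine (r ⊗ₜ s) = X.toAffine r ⊗ₜ X.toAffine s :=
  rfl

theorem tensorToAffine_mul (t u : X.CoordRing ⊗[X.baseRing] X.CoordRing) :
    X.tensorToAffine (t * u) = X.tensorToAffine t * X.tensorToAffine u := by
  induction t with
  | zero => simp
  | add t t' ht ht' => rw [add_mul, map_add, map_add, add_mul, ht, ht']
  | tmul a b =>
    induction u with
    | zero => simp
    | add u u' hu hu' => rw [mul_add, map_add, map_add, mul_add, hu, hu']
    | tmul c d =>
      simp only [Algebra.TensorProduct.tmul_mul_tmul, tensorToAffine_tmul, map_mul]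

theorem lmul'_tensorToAffine (t : X.CoordRing ⊗[X.baseRing] X.CoordRing) :
    Algebra.TensorProduct.lmul' K (X.tensorToAffine t) =
      X.toAffine (Algebra.TensorProduct.lmul' X.baseRing t) := by
  induction t with
  | zero => simp
  | add t t' ht ht' => rw [map_add, map_add, map_add, map_add, ht, ht']
  | tmul a b =>
    rw [tensorToAffine_tmul, Algebra.TensorProduct.lmul'_apply_tmul,
      Algebra.TensorProduct.lmul'_apply_tmul, map_mul]

theorem toAffine_mem_noetherDifferentIdeal {r : X.CoordRing} (hr : r ∈ X.noetherDifferent) :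
    X.toAffine r ∈ noetherDifferentIdeal K X.AffineCoordRing := by
  obtain ⟨t, ht, rfl⟩ := (mem_noetherDifferentIdeal_iff r).1 hr
  refine (mem_noetherDifferentIdeal_iff _).2
    ⟨X.tensorToAffine t, fun y => ?_, X.lmul'_tensorToAffine t⟩
  obtain ⟨y, rfl⟩ := X.toAffine_surjective y
  have := congrArg X.tensorToAffine (ht y)
  simpa only [tensorToAffine_mul, tensorToAffine_tmul, map_one] using this

-- `σ i` is homogenization to degree `i`, inverse to `R_i ≅ S`; below `D` its values are irrelevant.
variable {X} in
theorem exists_component_section (hX : X.AvoidsHyperplane) :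
    ∃ (D : ℕ) (σ : ℕ → X.AffineCoordRing →ₗ[K] X.CoordRing), ∀ i, D ≤ i →
      (∀ s, σ i s ∈ X.component i) ∧ (∀ s, X.toAffine (σ i s) = s) ∧
      ∀ r ∈ X.component i, σ i (X.toAffine r) = r := by
  obtain ⟨D, hD⟩ := X.exists_component_surjective hX
  have key : ∀ i, ∃ σ : X.AffineCoordRing →ₗ[K] X.CoordRing, D ≤ i →
      (∀ s, σ s ∈ X.component i) ∧ (∀ s, X.toAffine (σ s) = s) ∧
      ∀ r ∈ X.component i, σ (X.toAffine r) = r := by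
    intro i
    by_cases hi : D ≤ i
    · let f : X.component i →ₗ[K] X.AffineCoordRing :=
        X.toAffine.toLinearMap ∘ₗ (X.component i).subtype
      have hf : Function.Bijective f := by
        refine ⟨?_, fun s => ?_⟩
        · rw [← LinearMap.ker_eq_bot, LinearMap.ker_eq_bot']
          exact fun r hr => Subtype.ext (X.toAffine_injOn_component hX r.2 hr)
        · obtain ⟨r, hr, rfl⟩ := hD i hi s
          exact ⟨⟨r, hr⟩, rfl⟩
      let e := LinearEquiv.ofBijective f hf
      exact ⟨(X.component i).subtype ∘ₗ e.symm.toLinearMap, fun _ => ⟨fun s => (e.symm s).2,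
        fun s => e.apply_symm_apply s,
        fun r hr => congrArg Subtype.val (e.symm_apply_apply ⟨r, hr⟩)⟩⟩
    · exact ⟨0, fun h => absurd h hi⟩
  choose σ hσ using key
  exact ⟨D, σ, hσ⟩

/-- Every element of the Noether different of `S` lifts to all large degrees. -/
theorem exists_lift_noetherDifferent (hX : X.AvoidsHyperplane) :
    ∃ D : ℕ, ∀ i, D ≤ i → ∀ s ∈ noetherDifferentIdeal K X.AffineCoordRing,
      ∃ r ∈ X.noetherDifferent, r ∈ X.component i ∧ X.toAffine r = s := by
  obtain ⟨D, σ, hσ⟩ := exists_component_section hX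
  have hσX : ∀ i, D ≤ i → ∀ (j : Fin (n + 1)) s,
      σ (i + 1) (X.toAffine (X.toCoordRing (MvPolynomial.X j)) * s) =
        X.toCoordRing (MvPolynomial.X j) * σ i s := by
    intro i hi j s
    obtain ⟨h1, h2, -⟩ := hσ i hi
    obtain ⟨-, -, h3⟩ := hσ (i + 1) (by omega)
    rw [← h3 (X.toCoordRing (MvPolynomial.X j) * σ i s), map_mul X.toAffine, h2]
    rw [add_comm i 1]
    exact X.mul_mem_component (X.toCoordRing_X_mem_component j) (h1 s)
  have hσ0 : ∀ i, D ≤ i → ∀ s, σ (i + 1) s = X.x₀ * σ i s := by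
    intro i hi s
    have := hσX i hi 0 s
    rwa [show X.toCoordRing (MvPolynomial.X 0) = X.x₀ from rfl, X.toAffine_x₀, one_mul] at this
  let x : X.baseRing := ⟨X.x₀, Algebra.subset_adjoin rfl⟩
  let F : ℕ → ℕ → X.AffineCoordRing ⊗[K] X.AffineCoordRing →ₗ[K]
      X.CoordRing ⊗[X.baseRing] X.CoordRing := fun i k =>
    (TensorProduct.mapOfCompatibleSMul X.baseRing K K X.CoordRing X.CoordRing) ∘ₗ
      TensorProduct.map (σ i) (σ k)
  have hF : ∀ i k a b, F i k (a ⊗ₜ b) = σ i a ⊗ₜ σ k b := fun i k a b => rfl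
  -- Bidegrees `(i + 1, i)` and `(i, i + 1)` agree because both equal `F i i t` times `x₀`, moved
  -- across the tensor sign over `K[x₀]`.
  have hswap : ∀ i, D ≤ i → ∀ t, F (i + 1) i t = F i (i + 1) t := by
    intro i hi t
    induction t with
    | zero => simp
    | add t u ht hu => rw [map_add, map_add, ht, hu]
    | tmul a b =>
      rw [hF, hF, hσ0 i hi, hσ0 i hi]
      exact TensorProduct.smul_tmul x (σ i a) (σ i b)
  have hleft : ∀ i, D ≤ i → ∀ (j : Fin (n + 1)) t,
      (X.toCoordRing (MvPolynomial.X j) ⊗ₜ[X.baseRing] 1) * F i i t =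
        F (i + 1) i ((X.toAffine (X.toCoordRing (MvPolynomial.X j)) ⊗ₜ 1) * t) := by
    intro i hi j t
    induction t with
    | zero => simp
    | add t u ht hu => rw [map_add, mul_add, mul_add, map_add, ht, hu]
    | tmul a b =>
      rw [Algebra.TensorProduct.tmul_mul_tmul, hF, hF, Algebra.TensorProduct.tmul_mul_tmul,
        hσX i hi, one_mul, one_mul]
  have hright : ∀ i, D ≤ i → ∀ (j : Fin (n + 1)) t,
      (1 ⊗ₜ[X.baseRing] X.toCoordRing (MvPolynomial.X j)) * F i i t =
        F i (i + 1) ((1 ⊗ₜ X.toAffine (X.toCoordRing (MvPolynomial.X j))) * t) := by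
    intro i hi j t
    induction t with
    | zero => simp
    | add t u ht hu => rw [map_add, mul_add, mul_add, map_add, ht, hu]
    | tmul a b =>
      rw [Algebra.TensorProduct.tmul_mul_tmul, hF, hF, Algebra.TensorProduct.tmul_mul_tmul,
        hσX i hi, one_mul, one_mul]
  have hcomp : ∀ i, D ≤ i → ∀ t,
      Algebra.TensorProduct.lmul' X.baseRing (F i i t) ∈ X.component (i + i) := by
    intro i hi t
    induction t with
    | zero => simp
    | add t u ht hu => rw [map_add, map_add]; exact add_mem ht hu
    | tmul a b =>
      rw [hF, Algebra.TensorProduct.lmul'_apply_tmul]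
      exact X.mul_mem_component ((hσ i hi).1 a) ((hσ i hi).1 b)
  have hlmul : ∀ i, D ≤ i → ∀ t,
      X.toAffine (Algebra.TensorProduct.lmul' X.baseRing (F i i t)) =
        Algebra.TensorProduct.lmul' K t := by
    intro i hi t
    induction t with
    | zero => simp
    | add t u ht hu => rw [map_add, map_add, map_add, map_add, ht, hu]
    | tmul a b =>
      rw [hF, Algebra.TensorProduct.lmul'_apply_tmul, Algebra.TensorProduct.lmul'_apply_tmul,
        map_mul, (hσ i hi).2.1, (hσ i hi).2.1]
  -- The lift with both factors in degree `D` multiplies into degree `D + D`; powers of `x₀` reach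
  -- all higher degrees.
  refine ⟨D + D, fun i hi s hs => ?_⟩
  obtain ⟨t, ht, rfl⟩ := (mem_noetherDifferentIdeal_iff s).1 hs
  set r := Algebra.TensorProduct.lmul' X.baseRing (F D D t) with hrdef
  have hr : r ∈ X.noetherDifferent := by
    refine (mem_noetherDifferentIdeal_iff r).2 ⟨F D D t, fun y => ?_, rfl⟩
    obtain ⟨f, rfl⟩ := X.toCoordRing_surjective y
    -- The annihilator condition need only be checked on the variables.
    induction f using MvPolynomial.induction_on with
    | C a =>
      have h1 : X.toCoordRing (C a) ⊗ₜ[X.baseRing] (1 : X.CoordRing) =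
          1 ⊗ₜ[X.baseRing] X.toCoordRing (C a) := by
        have h2 : X.toCoordRing (C a) = algebraMap K X.baseRing a • (1 : X.CoordRing) := by
          rw [Subalgebra.smul_def, smul_eq_mul, mul_one]
          exact X.toCoordRing.commutes a
        rw [h2, TensorProduct.smul_tmul]
      rw [h1]
    | add p q hp hq =>
      rw [map_add, TensorProduct.add_tmul, TensorProduct.tmul_add, add_mul, add_mul, hp, hq]
    | mul_X p j hp =>
      have h1 : ((X.toCoordRing (MvPolynomial.X j)) ⊗ₜ[X.baseRing] (1 : X.CoordRing)) * F D D t =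
          (1 ⊗ₜ[X.baseRing] X.toCoordRing (MvPolynomial.X j)) * F D D t := by
        rw [hleft D le_rfl, hright D le_rfl, hswap D le_rfl, ht]
      have h2 : ∀ a b : X.CoordRing, (a * b) ⊗ₜ[X.baseRing] (1 : X.CoordRing) =
          (a ⊗ₜ 1) * (b ⊗ₜ 1) := fun a b => by
        rw [Algebra.TensorProduct.tmul_mul_tmul, one_mul]
      have h3 : ∀ a b : X.CoordRing, (1 : X.CoordRing) ⊗ₜ[X.baseRing] (a * b) =
          (1 ⊗ₜ a) * (1 ⊗ₜ b) := fun a b => by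
        rw [Algebra.TensorProduct.tmul_mul_tmul, one_mul]
      rw [map_mul, h2, h3, mul_assoc, h1, mul_left_comm, hp, mul_left_comm, mul_assoc]
  have hx : ∀ k, X.x₀ ^ k ∈ X.component k := fun k =>
    ⟨MvPolynomial.X 0 ^ k, isHomogeneous_X_pow 0 k, map_pow X.toCoordRing _ k⟩
  refine ⟨X.x₀ ^ (i - (D + D)) * r, Ideal.mul_mem_left _ _ hr, ?_, ?_⟩
  · have := X.mul_mem_component (hx (i - (D + D))) (hcomp D le_rfl t)
    rwa [Nat.sub_add_cancel hi] at this
  · rw [map_mul, map_pow, X.toAffine_x₀, one_pow, one_mul, hrdef, hlmul D le_rfl]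

theorem hilbertFunction_noetherDifferent (hX : X.AvoidsHyperplane) :
    ∃ D : ℕ, ∀ i, D ≤ i → X.hilbertFunction X.noetherDifferent i =
      Module.finrank K ((noetherDifferentIdeal K X.AffineCoordRing).restrictScalars K) := by
  obtain ⟨D, hD⟩ := X.exists_lift_noetherDifferent hX
  refine ⟨D, fun i hi => ?_⟩
  let f : ↥(X.noetherDifferent.restrictScalars K ⊓ X.component i) →ₗ[K]
      (noetherDifferentIdeal K X.AffineCoordRing).restrictScalars K :=
    X.toAffine.toLinearMap.restrict fun r hr => X.toAffine_mem_noetherDifferentIdeal hr.1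
  refine (LinearEquiv.ofBijective f ⟨?_, fun s => ?_⟩).finrank_eq
  · rw [← LinearMap.ker_eq_bot, LinearMap.ker_eq_bot']
    exact fun r hr => Subtype.ext
      (X.toAffine_injOn_component hX r.2.2 (congrArg Subtype.val hr))
  · obtain ⟨r, hr, hri, hrs⟩ := hD i hi s s.2
    exact ⟨⟨r, hr, hri⟩, Subtype.ext hrs⟩

end ZeroDimSubscheme

end

/-! ### The Hilbert polynomial and the locally Gorenstein criterion. -/

theorem corollary4p4 {K : Type*} [Field K] {n : ℕ} (X : ZeroDimSubscheme K n)
    (hchar : ringChar K = 0 ∨ X.degree < ringChar K) (hX : X.AvoidsHyperplane) :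
    Finite X.ClosedPoint ∧
    X.IsHilbertPolynomial X.noetherDifferent (X.hilbertPolynomial X.noetherDifferent) ∧
    X.hilbertPolynomial X.noetherDifferent =
      Polynomial.C ((∑ᶠ p ∈ X.gorensteinPoints, X.residueDegree p : ℕ) : ℚ) ∧
    (X.IsLocallyGorenstein ↔
      X.hilbertPolynomial X.noetherDifferent =
        Polynomial.C ((∑ᶠ p : X.ClosedPoint, X.residueDegree p : ℕ) : ℚ)) := by
  classical
  have hfd : FiniteDimensional K X.AffineCoordRing := X.finiteDimensional_affineCoordRing hX
  have hart : IsArtinianRing X.AffineCoordRing := IsArtinianRing.of_finite K _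
  have hfin : Finite X.ClosedPoint := inferInstance
  have : Fintype X.ClosedPoint := Fintype.ofFinite _
  have hsum : Module.finrank K ((noetherDifferentIdeal K X.AffineCoordRing).restrictScalars K) =
      ∑ᶠ p ∈ X.gorensteinPoints, X.residueDegree p := by
    rw [finrank_noetherDifferentIdeal hchar, finsum_mem_def, finsum_eq_sum_of_fintype]
    exact Finset.sum_congr rfl fun p _ => rfl
  have hC : X.IsHilbertPolynomial X.noetherDifferent
      (Polynomial.C ((∑ᶠ p ∈ X.gorensteinPoints, X.residueDegree p : ℕ) : ℚ)) := by
    obtain ⟨D, hD⟩ := X.hilbertFunction_noetherDifferent hX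
    exact ⟨D, fun i hi => by rw [hD i hi, hsum, Polynomial.eval_C]⟩
  have hHP : X.IsHilbertPolynomial X.noetherDifferent (X.hilbertPolynomial X.noetherDifferent) := by
    have hex : ∃ p, X.IsHilbertPolynomial X.noetherDifferent p := ⟨_, hC⟩
    rw [ZeroDimSubscheme.hilbertPolynomial, dif_pos hex]
    exact hex.choose_spec
  have heq := hHP.unique hC
  refine ⟨hfin, hHP, heq, ?_⟩
  rw [heq, Polynomial.C_inj, Nat.cast_inj]
  constructor
  · intro h
    rw [show X.gorensteinPoints = Set.univ from Set.eq_univ_of_forall h, finsum_mem_univ]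
  · intro h p
    rw [finsum_mem_def, finsum_eq_sum_of_fintype, finsum_eq_sum_of_fintype] at h
    have hle : ∀ q ∈ Finset.univ, X.gorensteinPoints.indicator X.residueDegree q ≤
        X.residueDegree q := fun q _ => Set.indicator_le_self' (fun _ _ => Nat.zero_le _) q
    -- Equal sums with termwise inequality force equal terms, and residue degrees are positive.
    have hp := (Finset.sum_eq_sum_iff_of_le hle).1 h p (Finset.mem_univ p)
    by_contra hG
    rw [Set.indicator_of_notMem (s := X.gorensteinPoints) hG] at hp
    have : 0 < X.residueDegree p := Module.finrank_pos
    omega
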